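/- **Definitions.** Let $\mathcal A$ be a unital $*$-algebra over $\mathbb C$ and $\phi,\psi$ states (positive unital linear functionals) on it. Let $NC(n)$ be the set of non-crossing partitions of $\{1,\dots,n\}$. A block $V$ of $\pi\in NC(n)$ is *inner* if there are $y_1,y_2$ in one block of $\pi$ with $y_1<x<y_2$ for all $x\in V$, and *outer* otherwise. The free cumulants $R^\psi$ and the two-state free cumulants $R^{\phi,\psi}$ are defined recursively by $$\psi[a_1\cdots a_n]=\sum_{\pi\in NC(n)}\prod_{V\in\pi}R^\psi(a_1,\dots,a_n:V),$$ $$\phi[a_1\cdots a_n]=\sum_{\pi\in NC(n)}\ \prod_{V\text{ outer}}R^{\phi,\psi}(a_1,\dots,a_n:V)\prod_{V\text{ inner}}R^{\psi}(a_1,\dots,a_n:V)\qquad(n\ge 1),$$ where $f(a_1,\dots,a_n:V)=f(a_{i(1)},\dots,a_{i(k)})$ for $V=\{i(1)<\dots<i(k)\}$. Write $R^\psi_n(x)=R^\psi(x,\dots,x)$ and $R^{\phi,\psi}_n(x)=R^{\phi,\psi}(x,\dots,x)$ ($n$ arguments). Unital subalgebras $(\mathcal A_i)_i$ are *two-state freely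 independent* if for all $n\ge1$ and $a_j\in\mathcal A_{i(j)}$ ($1\le j\le n$) with $i(j)\ne i(j+1)$ and all $\psi[a_j]=0$, one has $\psi[a_1\cdots a_n]=0$ and $\phi[a_1\cdots a_n]=\phi[a_1]\cdots\phi[a_n]$. Elements are two-state freely independent if the unital subalgebras they generate are. Let $T>0$. A family $\{X(t)\}_{0\le t\le T}$ of self-adjoint elements of $\mathcal A$ is an *algebraic two-state free Brownian motion* if $X(0)=0$; $\phi[X(t)]=0$ for all $t$; the increments $X(t_i)-X(s_i)$ over finitely many pairwise disjoint intervals $[s_i,t_i)\subset[0,T]$ are two-state freely independent; the distributions of the increments with respect to $\phi$ and to $\psi$ are stationary (i.e. $X(t+h)-X(s+h)$ and $X(t)-X(s)$ have the same moments); and for $0\le s\le t\le T$ $$R^{\phi,\psi}_n(X(t)-X(s))=0\ \text{ for all } n>2,\qquad \phi[(X(t)-X(s))^2]=t-s.$$ For $\alpha\in\mathbb R$, it is a *two-state free Brownian motion with parameter $\alpha$* if moreover, for all $t\in[0,T]$, $R^\psi_1(X(t))=\alpha t$, $R^\psi_2(X(t))=R^{\phi,\psi}_2(X(t))=t$, and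 $R^\psi_k(X(t))=0$ for all $k>2$. **Statement.** Let $\mathcal A$ be a unital $C^*$-algebra, $\phi,\psi$ states on $\mathcal A$ with $\phi$ faithful (i.e. $\phi[a^*a]=0$ implies $a=0$), and $T>0$. Suppose that $\mathcal A$ is generated, as a $C^*$-algebra, by an algebraic two-state free Brownian motion $\{X(t)\}_{0\le t\le T}$ all of whose $\psi$-free cumulants are non-negative: $R^\psi_n(X(t))\ge0$ for all $n\ge1$ and $t\in[0,T]$. Suppose also that, in the operator norm, $$\lim_{N\to\infty}\sum_{i=1}^N\Bigl(X\bigl(\tfrac iNT\bigr)-X\bigl(\tfrac{i-1}NT\bigr)\Bigr)^k=0\quad\text{for every integer }k>2,\qquad \lim_{N\to\infty}\sum_{i=1}^N\Bigl(X\bigl(\tfrac iNT\bigr)-X\bigl(\tfrac{i-1}NT\bigr)\Bigr)^2=T\cdot 1 .$$ Then there is $\alpha\in\mathbb R$ such that $\{X(t)\}_{0\le t\le T}$ is a two-state free Brownian motion with parameter $\alpha$. -/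

import Mathlib

open Filter Topology
open scoped ComplexOrder

noncomputable section

namespace TwoStateFree

/-! ### Non-crossing partitions of `Fin n` -/

/-- A partition of `{0, …, n-1}` is non-crossing if `x₁ < y₁ < x₂ < y₂` with `x₁, x₂` in a block `U`
and `y₁, y₂` in a block `V` forces `U = V`. -/
def IsNonCrossing {n : ℕ} (P : Finpartition (Finset.univ : Finset (Fin n))) : Prop :=
  ∀ U ∈ P.parts, ∀ V ∈ P.parts, ∀ x₁ ∈ U, ∀ y₁ ∈ V, ∀ x₂ ∈ U, ∀ y₂ ∈ V,
    x₁ < y₁ → y₁ < x₂ → x₂ < y₂ → U = V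

/-- The block `V` is inner: it lies strictly between two points `y₁ < y₂` of one single block
(which is then necessarily another block). Blocks that are not inner are outer. -/
def IsInner {n : ℕ} (P : Finpartition (Finset.univ : Finset (Fin n))) (V : Finset (Fin n)) : Prop :=
  ∃ U ∈ P.parts, ∃ y₁ ∈ U, ∃ y₂ ∈ U, ∀ x ∈ V, y₁ < x ∧ x < y₂

open Classical in
/-- The finite set `NC(n)` of non-crossing partitions. -/
def NC (n : ℕ) : Finset (Finpartition (Finset.univ : Finset (Fin n))) :=
  Finset.univ.filter IsNonCrossing

open Classical in
/-- The non-crossing partitions different from the one-block partition, i.e. those all of whose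
blocks have fewer than `n` elements. -/
def properNC (n : ℕ) : Finset (Finpartition (Finset.univ : Finset (Fin n))) :=
  (NC n).filter fun P => ∀ V ∈ P.parts, V.card < n

/-- The tuple `(a_{i(1)}, …, a_{i(k)})` where `V = {i(1) < … < i(k)}`. -/
def restrict {A : Type*} {n : ℕ} (a : Fin n → A) (V : Finset (Fin n)) : Fin V.card → A :=
  fun j => a (V.orderEmbOfFin rfl j)

lemma restrict_univ_congr {A : Type*} {n : ℕ} (F : (m : ℕ) → (Fin m → A) → ℂ) (a : Fin n → A) :
    F (Finset.univ : Finset (Fin n)).card (restrict a Finset.univ) = F n a := by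
  have key : ∀ (m : ℕ) (h : (Finset.univ : Finset (Fin n)).card = m),
      F (Finset.univ : Finset (Fin n)).card (restrict a Finset.univ)
        = F m fun j => a ((Finset.univ : Finset (Fin n)).orderEmbOfFin h j) := by
    rintro m rfl; rfl
  rw [key n (by simp)]
  congr 1
  ext j
  congr 1
  have := Finset.orderEmbOfFin_unique' (s := (Finset.univ : Finset (Fin n))) (by simp)
    (f := (OrderIso.refl (Fin n)).toOrderEmbedding) (by simp)
  rw [← this]
  rfl

/-! ### Free and two-state free cumulants -/

section Cumulants

variable {A : Type*} [Ring A] [Algebra ℂ A]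

/-- The moment `ψ[a₁ a₂ ⋯ aₙ]`. -/
def moment (ψ : A →ₗ[ℂ] ℂ) {n : ℕ} (a : Fin n → A) : ℂ := ψ (List.ofFn a).prod

/-- The free cumulant functional `R^ψ(a₁, …, aₙ)`: the moment-cumulant formula
`ψ[a₁ ⋯ aₙ] = ∑_{π ∈ NC(n)} ∏_{V ∈ π} R^ψ(a : V)`, solved for the term of the one-block partition.
See `moment_eq_sum_freeCumulant`. (The `else` branch is never reached.) -/
def freeCumulant (ψ : A →ₗ[ℂ] ℂ) (n : ℕ) (a : Fin n → A) : ℂ :=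
  moment ψ a - ∑ P ∈ properNC n, ∏ V ∈ P.parts,
    if _h : V.card < n then freeCumulant ψ V.card (restrict a V) else 0
termination_by n

open Classical in
/-- The two-state free cumulant functional `R^{φ,ψ}(a₁, …, aₙ)`: the formula
`φ[a₁ ⋯ aₙ] = ∑_{π ∈ NC(n)} ∏_{V outer} R^{φ,ψ}(a : V) ∏_{V inner} R^ψ(a : V)`, solved for the
term of the one-block partition. See `moment_eq_sum_twoStateCumulant`. -/
def twoStateCumulant (φ ψ : A →ₗ[ℂ] ℂ) (n : ℕ) (a : Fin n → A) : ℂ :=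
  moment φ a - ∑ P ∈ properNC n, ∏ V ∈ P.parts,
    if IsInner P V then freeCumulant ψ V.card (restrict a V)
    else if _h : V.card < n then twoStateCumulant φ ψ V.card (restrict a V) else 0
termination_by n

/-- `R^ψ_n(x) = R^ψ(x, …, x)`. -/
def freeCumulantOf (ψ : A →ₗ[ℂ] ℂ) (n : ℕ) (x : A) : ℂ := freeCumulant ψ n fun _ => x

/-- `R^{φ,ψ}_n(x) = R^{φ,ψ}(x, …, x)`. -/
def twoStateCumulantOf (φ ψ : A →ₗ[ℂ] ℂ) (n : ℕ) (x : A) : ℂ := twoStateCumulant φ ψ n fun _ => x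

lemma univ_mem_parts_of_not_proper {n : ℕ}
    (P : Finpartition (Finset.univ : Finset (Fin n))) :
    (¬ ∀ V ∈ P.parts, V.card < n) ↔ P.parts = {Finset.univ} := by
  constructor
  · intro h
    push Not at h
    obtain ⟨V, hV, hc⟩ := h
    have hVu : V = Finset.univ := by
      rw [← Finset.card_eq_iff_eq_univ, Fintype.card_fin]
      exact le_antisymm (by simpa using Finset.card_le_univ V) hc
    subst hVu
    ext W
    simp only [Finset.mem_singleton]
    constructor
    · intro hW
      obtain ⟨x, hx⟩ := P.nonempty_of_mem_parts hW
      exact P.eq_of_mem_parts hW hV hx (Finset.mem_univ x)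
    · rintro rfl; exact hV
  · intro h h'
    have := h' Finset.univ (by simp [h])
    simp at this

/-- The one-block partition. -/
def oneBlock (n : ℕ) (hn : n ≠ 0) : Finpartition (Finset.univ : Finset (Fin n)) :=
  Finpartition.indiscrete (by
    have : NeZero n := ⟨hn⟩
    exact Finset.univ_nonempty.ne_empty)

lemma NC_eq (n : ℕ) (hn : n ≠ 0) :
    oneBlock n hn ∉ properNC n ∧ ∀ P, P ∈ NC n ↔ P = oneBlock n hn ∨ P ∈ properNC n := by
  have h1 : (oneBlock n hn).parts = {Finset.univ} := rfl
  refine ⟨?_, fun P => ?_⟩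
  · intro h
    exact (univ_mem_parts_of_not_proper _).2 h1 (Finset.mem_filter.1 h).2
  · by_cases hP : ∀ V ∈ P.parts, V.card < n
    · have : P ≠ oneBlock n hn := by
        rintro rfl
        exact (univ_mem_parts_of_not_proper _).2 h1 hP
      simp only [this, false_or, properNC, Finset.mem_filter]
      tauto
    · have h2 := (univ_mem_parts_of_not_proper P).1 hP
      have : P = oneBlock n hn := Finpartition.ext (h2.trans h1.symm)
      simp only [this, true_or, iff_true, NC, Finset.mem_filter, Finset.mem_univ, true_and]
      intro U hU V hV _ _ _ _ _ _ _ _ _ _ _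
      rw [h1, Finset.mem_singleton] at hU hV
      rw [hU, hV]

lemma sum_NC {n : ℕ} (hn : n ≠ 0)
    (f : Finpartition (Finset.univ : Finset (Fin n)) → ℂ) :
    ∑ P ∈ NC n, f P = f (oneBlock n hn) + ∑ P ∈ properNC n, f P := by
  classical
  obtain ⟨h1, h2⟩ := NC_eq n hn
  rw [← Finset.sum_insert h1]
  congr 1
  ext P
  simp [h2 P]

/-- The moment-cumulant formula for `R^ψ`. -/
theorem moment_eq_sum_freeCumulant (ψ : A →ₗ[ℂ] ℂ) {n : ℕ} (hn : n ≠ 0) (a : Fin n → A) :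
    moment ψ a = ∑ P ∈ NC n, ∏ V ∈ P.parts, freeCumulant ψ V.card (restrict a V) := by
  rw [sum_NC hn]
  have h1 : (oneBlock n hn).parts = {Finset.univ} := rfl
  rw [h1, Finset.prod_singleton, restrict_univ_congr (freeCumulant ψ) a, freeCumulant]
  rw [sub_add_eq_add_sub, eq_sub_iff_add_eq]
  congr 1
  refine Finset.sum_congr rfl fun P hP => Finset.prod_congr rfl fun V hV => ?_
  rw [dif_pos ((Finset.mem_filter.1 hP).2 V hV)]

open Classical in
/-- The moment-cumulant formula for `R^{φ,ψ}`. -/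
theorem moment_eq_sum_twoStateCumulant (φ ψ : A →ₗ[ℂ] ℂ) {n : ℕ} (hn : n ≠ 0) (a : Fin n → A) :
    moment φ a = ∑ P ∈ NC n,
      (∏ V ∈ P.parts with ¬ IsInner P V, twoStateCumulant φ ψ V.card (restrict a V)) *
        ∏ V ∈ P.parts with IsInner P V, freeCumulant ψ V.card (restrict a V) := by
  have hprod : ∀ P : Finpartition (Finset.univ : Finset (Fin n)),
      (∏ V ∈ P.parts with ¬ IsInner P V, twoStateCumulant φ ψ V.card (restrict a V)) *
        (∏ V ∈ P.parts with IsInner P V, freeCumulant ψ V.card (restrict a V)) =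
      ∏ V ∈ P.parts, if IsInner P V then freeCumulant ψ V.card (restrict a V)
        else twoStateCumulant φ ψ V.card (restrict a V) := by
    intro P
    rw [Finset.prod_ite, mul_comm]
  simp only [hprod]
  rw [sum_NC hn]
  have h1 : (oneBlock n hn).parts = {Finset.univ} := rfl
  have h2 : ¬ IsInner (oneBlock n hn) Finset.univ := by
    rintro ⟨U, -, y₁, -, y₂, -, h⟩
    exact lt_irrefl _ (h y₁ (Finset.mem_univ _)).1
  rw [h1, Finset.prod_singleton, if_neg h2, restrict_univ_congr (twoStateCumulant φ ψ) a,
    twoStateCumulant, sub_add_eq_add_sub, eq_sub_iff_add_eq]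
  congr 1
  refine Finset.sum_congr rfl fun P hP => Finset.prod_congr rfl fun V hV => ?_
  rw [dif_pos ((Finset.mem_filter.1 hP).2 V hV)]

end Cumulants

/-! ### States and two-state free independence -/

section Processes

variable {A : Type*} [Ring A] [StarRing A] [Algebra ℂ A]

/-- A state: a positive unital linear functional. -/
structure IsState (φ : A →ₗ[ℂ] ℂ) : Prop where
  nonneg : ∀ a : A, 0 ≤ φ (star a * a)
  map_one : φ 1 = 1

/-- A functional is faithful if `φ[a* a] = 0` only for `a = 0`. -/
def IsFaithful (φ : A →ₗ[ℂ] ℂ) : Prop :=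
  ∀ a : A, φ (star a * a) = 0 → a = 0

/-- The (unital) subalgebras `B i` are two-state freely independent: for every alternating word of
length `n + 1 ≥ 1` in `ψ`-centered elements, `ψ` of the product vanishes (that is, the family is
`ψ`-freely independent) and `φ` of the product is the product of the values of `φ`. -/
def IsTwoStateFree (φ ψ : A →ₗ[ℂ] ℂ) {ι : Type*} (B : ι → Subalgebra ℂ A) : Prop :=
  ∀ (n : ℕ) (i : Fin (n + 1) → ι) (a : Fin (n + 1) → A),
    (∀ j, a j ∈ B (i j)) → (∀ j : Fin n, i j.castSucc ≠ i j.succ) → (∀ j, ψ (a j) = 0) →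
      ψ (List.ofFn a).prod = 0 ∧ φ (List.ofFn a).prod = ∏ j, φ (a j)

/-- `{X(t), 0 ≤ t ≤ T}` is a process with two-state freely independent increments. Only the values
of `X` on `[0, T]` matter. -/
structure HasTwoStateFreeIncrements (φ ψ : A →ₗ[ℂ] ℂ) (T : ℝ) (X : ℝ → A) : Prop where
  selfAdjoint : ∀ t ∈ Set.Icc 0 T, IsSelfAdjoint (X t)
  zero : X 0 = 0
  /-- The increments over finitely many pairwise disjoint intervals `[s i, t i)` are two-state
  freely independent (that is, the unital algebras they generate are). -/
  free : ∀ (k : ℕ) (s t : Fin k → ℝ), (∀ i, 0 ≤ s i ∧ s i ≤ t i ∧ t i ≤ T) →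
    (∀ i j, i ≠ j → Disjoint (Set.Ico (s i) (t i)) (Set.Ico (s j) (t j))) →
    IsTwoStateFree φ ψ fun i => Algebra.adjoin ℂ {X (t i) - X (s i)}
  mean_zero : ∀ t ∈ Set.Icc 0 T, φ (X t) = 0
  stationary : ∀ s t h : ℝ, 0 ≤ s → s ≤ t → 0 ≤ h → t + h ≤ T → ∀ n : ℕ,
    φ ((X (t + h) - X (s + h)) ^ n) = φ ((X t - X s) ^ n) ∧
    ψ ((X (t + h) - X (s + h)) ^ n) = ψ ((X t - X s) ^ n)

/-- `x` has a two-state normal distribution. -/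
def IsTwoStateNormal (φ ψ : A →ₗ[ℂ] ℂ) (x : A) : Prop :=
  ∀ n : ℕ, 2 < n → twoStateCumulantOf φ ψ n x = 0

/-- An algebraic two-state free Brownian motion on `[0, T]`. -/
structure IsAlgebraicTwoStateFreeBM (φ ψ : A →ₗ[ℂ] ℂ) (T : ℝ) (X : ℝ → A) : Prop
    extends HasTwoStateFreeIncrements φ ψ T X where
  normal : ∀ s t : ℝ, 0 ≤ s → s ≤ t → t ≤ T → IsTwoStateNormal φ ψ (X t - X s)
  variance : ∀ s t : ℝ, 0 ≤ s → s ≤ t → t ≤ T →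
    φ ((X t - X s) ^ 2) = ((t - s : ℝ) : ℂ)

/-- A two-state free Brownian motion with parameter `α` on `[0, T]`: an algebraic two-state free
Brownian motion with `R^ψ_1(X(t)) = α t`, `R^ψ_2(X(t)) = R^{φ,ψ}_2(X(t)) = t`, and
`R^ψ_k(X(t)) = 0` for `k > 2`. -/
structure IsTwoStateFreeBM (φ ψ : A →ₗ[ℂ] ℂ) (T : ℝ) (X : ℝ → A) (α : ℝ) : Prop
    extends IsAlgebraicTwoStateFreeBM φ ψ T X where
  cumulant_one : ∀ t ∈ Set.Icc 0 T, freeCumulantOf ψ 1 (X t) = ((α * t : ℝ) : ℂ)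
  cumulant_two : ∀ t ∈ Set.Icc 0 T, freeCumulantOf ψ 2 (X t) = (t : ℂ) ∧
    twoStateCumulantOf φ ψ 2 (X t) = (t : ℂ)
  cumulant_higher : ∀ k : ℕ, 2 < k → ∀ t ∈ Set.Icc 0 T, freeCumulantOf ψ k (X t) = 0

/-- The sums `∑_{i=1}^N (X(iT/N) - X((i-1)T/N))^k`, whose limit is `∫_0^T (dX(t))^k`. -/
def variationSum (T : ℝ) (X : ℝ → A) (k N : ℕ) : A :=
  ∑ i ∈ Finset.range N, (X (((i : ℝ) + 1) / N * T) - X ((i : ℝ) / N * T)) ^ k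

end Processes

end TwoStateFree

end

/-! Free increments make the free cumulants of `X t` under `ψ` additive in time, so `X (T / N)` has
`k`-th cumulant `R_k(X T) / N`. By stationarity `ψ` of the `k`-th variation sum is `N ψ[X(T/N)^k]`.
In the moment-cumulant expansion of this number a partition with `b` blocks contributes order `N^(1
- b)`, so only the one-block term `R_k(X T)` survives as `N → ∞` (`tendsto_map_variationSum`).
States are norm-continuous, so the assumed limits give `R_2(X T) = T` and `R_k(X T) = 0` for `k >
2`. Non-negativity turns additivity in time into linearity, which carries these values from `T` to
every `t` and gives `α = R_1(X T) / T`. The second two-state cumulant is just the `φ`-variance,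
because the `φ`-mean vanishes.

The main work is additivity of free cumulants on free elements (`freeCumulantOf_add`). It goes
through the Wick polynomials `B n` of `x`, with generating function `(1 + ∑ r_k z^k - x z)⁻¹`.
Expanding `x^n` in the `B k` by partitions with open elements shows that `r` is the cumulant
sequence of `x` exactly when all `B n`, `n ≥ 1`, are `ψ`-centered. For free `x` and `y`, the Wick
polynomials of `x + y` built from the sum of the two cumulant sequences are combinations of
alternating centered words, hence centered. -/

noncomputable section

namespace TwoStateFree

/-! ### Non-crossing partitions with open elements -/

section OpenPartitions

variable {α : Type*} [LinearOrder α]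

/-- `Q` is a non-crossing partition of `s \ O`, no block of which has an element of `O` strictly
between two of its points. The elements of `O` are thought of as waiting for a block to the right
of `s`. -/
structure IsOpenNC (s O : Finset α) (Q : Finset (Finset α)) : Prop where
  open_subset : O ⊆ s
  subset : ∀ V ∈ Q, V ⊆ s
  nonempty : ∀ V ∈ Q, V.Nonempty
  notMem_open : ∀ V ∈ Q, ∀ x ∈ V, x ∉ O
  eq_of_mem : ∀ U ∈ Q, ∀ V ∈ Q, ∀ x ∈ U, x ∈ V → U = V
  cover : ∀ x ∈ s, x ∉ O → ∃ V ∈ Q, x ∈ V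
  noncrossing : ∀ U ∈ Q, ∀ V ∈ Q, ∀ x₁ ∈ U, ∀ y₁ ∈ V, ∀ x₂ ∈ U, ∀ y₂ ∈ V,
    x₁ < y₁ → y₁ < x₂ → x₂ < y₂ → U = V
  not_between : ∀ V ∈ Q, ∀ x ∈ V, ∀ y ∈ V, ∀ o ∈ O, x < o → ¬ o < y

open Classical in
/-- The finite set of pairs `(O, Q)` with `IsOpenNC s O Q`. -/
def openNC (s : Finset α) : Finset (Finset α × Finset (Finset α)) :=
  (s.powerset ×ˢ s.powerset.powerset).filter fun p => IsOpenNC s p.1 p.2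

lemma mem_openNC {s : Finset α} {p : Finset α × Finset (Finset α)} :
    p ∈ openNC s ↔ IsOpenNC s p.1 p.2 := by
  simp only [openNC, Finset.mem_filter, Finset.mem_product, Finset.mem_powerset,
    and_iff_right_iff_imp]
  exact fun h => ⟨h.open_subset, fun V hV => Finset.mem_powerset.2 (h.subset V hV)⟩

lemma openNC_empty : openNC (∅ : Finset α) = {(∅, ∅)} := by
  ext ⟨O, Q⟩
  simp only [mem_openNC, Finset.mem_singleton, Prod.mk.injEq]
  constructor
  · intro h
    refine ⟨Finset.subset_empty.1 h.open_subset, Finset.eq_empty_of_forall_notMem fun V hV => ?_⟩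
    obtain ⟨x, hx⟩ := h.nonempty V hV
    simpa using h.subset V hV hx
  · rintro ⟨rfl, rfl⟩
    constructor <;> simp

lemma exists_upper_subset (O : Finset α) {k : ℕ} (hk : k ≤ O.card) :
    ∃ K ⊆ O, K.card = k ∧ ∀ x ∈ O \ K, ∀ y ∈ K, x < y := by
  induction k with
  | zero => exact ⟨∅, by simp⟩
  | succ k ih =>
    obtain ⟨K, hK, hc, hlt⟩ := ih (by omega)
    have hne : (O \ K).Nonempty := by
      rw [← Finset.card_pos, Finset.card_sdiff_of_subset hK]; omega
    have hmem := Finset.max'_mem _ hne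
    set m := (O \ K).max' hne with hm
    rw [Finset.mem_sdiff] at hmem
    refine ⟨insert m K, ?_, ?_, ?_⟩
    · exact Finset.insert_subset hmem.1 hK
    · rw [Finset.card_insert_of_notMem hmem.2, hc]
    · intro x hx y hy
      simp only [Finset.mem_sdiff, Finset.mem_insert, not_or] at hx
      have hx' : x ∈ O \ K := Finset.mem_sdiff.2 ⟨hx.1, hx.2.2⟩
      rcases Finset.mem_insert.1 hy with rfl | hy
      · exact lt_of_le_of_ne (Finset.le_max' _ _ hx') hx.2.1
      · exact hlt x hx' y hy

/-- A topmost part of a set is determined by its size; this makes reopening a block reversible once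
the block's size is remembered. -/
lemma upper_subset_unique {O₁ O₂ K₁ K₂ : Finset α} (h : O₁ ∪ K₁ = O₂ ∪ K₂)
    (hc : K₁.card = K₂.card) (h₁ : ∀ x ∈ O₁, ∀ y ∈ K₁, x < y) (h₂ : ∀ x ∈ O₂, ∀ y ∈ K₂, x < y) :
    K₁ = K₂ := by
  by_cases hs : K₁ ⊆ K₂
  · exact Finset.eq_of_subset_of_card_le hs hc.ge
  · obtain ⟨a, ha, ha'⟩ := Finset.not_subset.1 hs
    have haO : a ∈ O₂ := by
      have : a ∈ O₂ ∪ K₂ := h ▸ Finset.mem_union_right _ ha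
      exact (Finset.mem_union.1 this).resolve_right ha'
    refine (Finset.eq_of_subset_of_card_le (fun b hb => ?_) hc.le).symm
    have : b ∈ O₁ ∪ K₁ := h ▸ Finset.mem_union_right _ hb
    refine (Finset.mem_union.1 this).resolve_left fun hb' => ?_
    exact lt_asymm (h₁ b hb' a ha) (h₂ a haO b hb)

variable {s O : Finset α} {Q : Finset (Finset α)} {m : α}

lemma IsOpenNC.insert_open (hm : ∀ x ∈ s, x < m) (h : IsOpenNC s O Q) :
    IsOpenNC (insert m s) (insert m O) Q where
  open_subset := Finset.insert_subset_insert _ h.open_subset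
  subset V hV := (h.subset V hV).trans (Finset.subset_insert _ _)
  nonempty := h.nonempty
  notMem_open V hV x hx := by
    have := hm x (h.subset V hV hx)
    simp [this.ne, h.notMem_open V hV x hx]
  eq_of_mem := h.eq_of_mem
  cover x hx hxO := by
    simp only [Finset.mem_insert, not_or] at hx hxO
    exact h.cover x (hx.resolve_left hxO.1) hxO.2
  noncrossing := h.noncrossing
  not_between V hV x hx y hy o ho h1 h2 := by
    rcases Finset.mem_insert.1 ho with rfl | ho
    · exact lt_asymm h2 (hm y (h.subset V hV hy))
    · exact h.not_between V hV x hx y hy o ho h1 h2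

lemma IsOpenNC.erase_open (hm : ∀ x ∈ s, x < m) (h : IsOpenNC (insert m s) O Q) (hmO : m ∈ O) :
    IsOpenNC s (O.erase m) Q where
  open_subset x hx :=
    (Finset.mem_insert.1 (h.open_subset (Finset.mem_of_mem_erase hx))).resolve_left
      (Finset.ne_of_mem_erase hx)
  subset V hV x hx := by
    refine (Finset.mem_insert.1 (h.subset V hV hx)).resolve_left ?_
    rintro rfl
    exact h.notMem_open V hV _ hx hmO
  nonempty := h.nonempty
  notMem_open V hV x hx hx' := h.notMem_open V hV x hx (Finset.mem_of_mem_erase hx')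
  eq_of_mem := h.eq_of_mem
  cover x hx hxO := by
    refine h.cover x (Finset.mem_insert_of_mem hx) fun hxO' => hxO ?_
    exact Finset.mem_erase.2 ⟨(hm x hx).ne, hxO'⟩
  noncrossing := h.noncrossing
  not_between V hV x hx y hy o ho := h.not_between V hV x hx y hy o (Finset.mem_of_mem_erase ho)

/-- The last element closes a block consisting of the topmost open elements. -/
lemma IsOpenNC.close (hm : ∀ x ∈ s, x < m) (h : IsOpenNC s O Q) {K : Finset α} (hK : K ⊆ O)
    (hlt : ∀ x ∈ O \ K, ∀ y ∈ K, x < y) :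
    IsOpenNC (insert m s) (O \ K) (insert (insert m K) Q) := by
  have hms : m ∉ s := fun h' => lt_irrefl _ (hm m h')
  have hlt' : ∀ x ∈ O \ K, ∀ y ∈ insert m K, x < y := by
    intro x hx y hy
    rcases Finset.mem_insert.1 hy with rfl | hy
    · exact hm x (h.open_subset (Finset.mem_sdiff.1 hx).1)
    · exact hlt x hx y hy
  have hdisj : ∀ V ∈ Q, ∀ x ∈ V, x ∉ insert m K := by
    intro V hV x hx hx'
    rcases Finset.mem_insert.1 hx' with rfl | hx'
    · exact hms (h.subset V hV hx)
    · exact h.notMem_open V hV x hx (hK hx')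
  refine ⟨?_, ?_, ?_, ?_, ?_, ?_, ?_, ?_⟩
  · exact (Finset.sdiff_subset.trans h.open_subset).trans (Finset.subset_insert _ _)
  · intro V hV
    rcases Finset.mem_insert.1 hV with rfl | hV
    · exact Finset.insert_subset_insert _ (hK.trans h.open_subset)
    · exact (h.subset V hV).trans (Finset.subset_insert _ _)
  · intro V hV
    rcases Finset.mem_insert.1 hV with rfl | hV
    · exact Finset.insert_nonempty _ _
    · exact h.nonempty V hV
  · intro V hV x hx hxO
    rcases Finset.mem_insert.1 hV with rfl | hV
    · exact lt_irrefl _ (hlt' x hxO x hx)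
    · exact h.notMem_open V hV x hx (Finset.mem_sdiff.1 hxO).1
  · intro U hU V hV x hxU hxV
    rcases Finset.mem_insert.1 hU with rfl | hU <;> rcases Finset.mem_insert.1 hV with rfl | hV
    · rfl
    · exact absurd hxU (hdisj V hV x hxV)
    · exact absurd hxV (hdisj U hU x hxU)
    · exact h.eq_of_mem U hU V hV x hxU hxV
  · intro x hx hxO
    by_cases hxm : x ∈ insert m K
    · exact ⟨_, Finset.mem_insert_self _ _, hxm⟩
    · simp only [Finset.mem_insert, not_or] at hxm
      have hxs := (Finset.mem_insert.1 hx).resolve_left hxm.1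
      obtain ⟨V, hV, hxV⟩ := h.cover x hxs fun h' => hxO (Finset.mem_sdiff.2 ⟨h', hxm.2⟩)
      exact ⟨V, Finset.mem_insert_of_mem hV, hxV⟩
  · intro U hU V hV x₁ hx₁ y₁ hy₁ x₂ hx₂ y₂ hy₂ h1 h2 h3
    rcases Finset.mem_insert.1 hU with rfl | hU' <;> rcases Finset.mem_insert.1 hV with rfl | hV'
    · rfl
    · exfalso
      rcases Finset.mem_insert.1 hx₂ with rfl | hx₂
      · exact lt_asymm h3 (hm _ (h.subset V hV' hy₂))
      · exact h.not_between V hV' y₁ hy₁ y₂ hy₂ x₂ (hK hx₂) h2 h3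
    · exfalso
      rcases Finset.mem_insert.1 hy₁ with rfl | hy₁
      · exact lt_asymm h2 (hm _ (h.subset U hU' hx₂))
      · exact h.not_between U hU' x₁ hx₁ x₂ hx₂ y₁ (hK hy₁) h1 h2
    · exact h.noncrossing U hU' V hV' x₁ hx₁ y₁ hy₁ x₂ hx₂ y₂ hy₂ h1 h2 h3
  · intro V hV x hx y hy o ho h1 h2
    rcases Finset.mem_insert.1 hV with rfl | hV
    · exact lt_asymm h1 (hlt' o ho x hx)
    · exact h.not_between V hV x hx y hy o (Finset.mem_sdiff.1 ho).1 h1 h2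

/-- An open element above some point of `V` would lie between that point and `m`, both in `V`. So
the other points of `V` were the topmost open elements before `m` closed the block. -/
lemma IsOpenNC.lt_of_block (h : IsOpenNC (insert m s) O Q) (hm : ∀ x ∈ s, x < m) (hmO : m ∉ O)
    {V : Finset α} (hV : V ∈ Q) (hmV : m ∈ V) : ∀ x ∈ O, ∀ y ∈ V, x < y := by
  intro x hx y hy
  have hxm : x < m :=
    hm x ((Finset.mem_insert.1 (h.open_subset hx)).resolve_left fun e => hmO (e ▸ hx))
  by_contra hlt
  have hne : y ≠ x := fun e => h.notMem_open V hV y hy (e ▸ hx)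
  exact h.not_between V hV y hy m hmV x hx (lt_of_le_of_ne (not_lt.1 hlt) hne) hxm

/-- Reopening the block of the last element. -/
lemma IsOpenNC.reopen (hm : ∀ x ∈ s, x < m) (h : IsOpenNC (insert m s) O Q) (hmO : m ∉ O)
    {V : Finset α} (hV : V ∈ Q) (hmV : m ∈ V) :
    IsOpenNC s (O ∪ V.erase m) (Q.erase V) := by
  have hsub : ∀ U ∈ Q.erase V, U ⊆ s := by
    intro U hU x hx
    obtain ⟨hne, hU⟩ := Finset.mem_erase.1 hU
    refine (Finset.mem_insert.1 (h.subset U hU hx)).resolve_left ?_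
    rintro rfl
    exact hne (h.eq_of_mem U hU V hV _ hx hmV)
  refine ⟨?_, hsub, ?_, ?_, ?_, ?_, ?_, ?_⟩
  · intro x hx
    rcases Finset.mem_union.1 hx with hx | hx
    · exact (Finset.mem_insert.1 (h.open_subset hx)).resolve_left fun e => hmO (e ▸ hx)
    · obtain ⟨hne, hx⟩ := Finset.mem_erase.1 hx
      exact (Finset.mem_insert.1 (h.subset V hV hx)).resolve_left hne
  · exact fun U hU => h.nonempty U (Finset.mem_of_mem_erase hU)
  · intro U hU x hx hx'
    obtain ⟨hne, hU⟩ := Finset.mem_erase.1 hU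
    rcases Finset.mem_union.1 hx' with hx' | hx'
    · exact h.notMem_open U hU x hx hx'
    · exact hne (h.eq_of_mem U hU V hV x hx (Finset.mem_of_mem_erase hx'))
  · exact fun U hU W hW => h.eq_of_mem U (Finset.mem_of_mem_erase hU) W (Finset.mem_of_mem_erase hW)
  · intro x hx hxO
    simp only [Finset.mem_union, Finset.mem_erase, not_or, not_and] at hxO
    obtain ⟨U, hU, hxU⟩ := h.cover x (Finset.mem_insert_of_mem hx) hxO.1
    refine ⟨U, Finset.mem_erase.2 ⟨?_, hU⟩, hxU⟩
    rintro rfl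
    exact hxO.2 (hm x hx).ne hxU
  · exact fun U hU W hW =>
      h.noncrossing U (Finset.mem_of_mem_erase hU) W (Finset.mem_of_mem_erase hW)
  · intro U hU x hx y hy o ho h1 h2
    have hym := hm y (hsub U hU hy)
    obtain ⟨hne, hU⟩ := Finset.mem_erase.1 hU
    rcases Finset.mem_union.1 ho with ho | ho
    · exact h.not_between U hU x hx y hy o ho h1 h2
    -- A reopened point `o` inside `U` would make `x < o < y < m` a crossing of `U` with `V`.
    · exact hne (h.noncrossing U hU V hV x hx o (Finset.mem_of_mem_erase ho) y hy m hmV h1 h2 hym)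

variable {M : Type*} [AddCommGroup M] [Module ℂ M]

-- Partitions in which the new maximum `m` stays open: they account for the term `B (n + 1)` of the
-- Wick recursion.
open Classical in
lemma sum_openNC_mem (hm : ∀ x ∈ s, x < m) (w : Finset (Finset α) → ℂ) (B : ℕ → M) :
    ∑ p ∈ openNC (insert m s) with m ∈ p.1, w p.2 • B p.1.card =
      ∑ p ∈ openNC s, w p.2 • B (p.1.card + 1) := by
  have hms : m ∉ s := fun h' => lt_irrefl _ (hm m h')
  refine Finset.sum_bij' (fun p _ => (p.1.erase m, p.2)) (fun p _ => (insert m p.1, p.2))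
    ?_ ?_ ?_ ?_ ?_
  · intro p hp
    obtain ⟨hp, hmp⟩ := Finset.mem_filter.1 hp
    exact mem_openNC.2 ((mem_openNC.1 hp).erase_open hm hmp)
  · intro p hp
    exact Finset.mem_filter.2 ⟨mem_openNC.2 ((mem_openNC.1 hp).insert_open hm),
      Finset.mem_insert_self _ _⟩
  · intro p hp
    obtain ⟨hp, hmp⟩ := Finset.mem_filter.1 hp
    simp [Finset.insert_erase hmp]
  · intro p hp
    have : m ∉ p.1 := fun h => hms ((mem_openNC.1 hp).open_subset h)
    simp [Finset.erase_insert this]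
  · intro p hp
    obtain ⟨hp, hmp⟩ := Finset.mem_filter.1 hp
    simp [Finset.card_erase_add_one hmp]

-- Partitions in which `m` closes a block: the block must take the topmost `k` open elements, so `k`
-- alone specifies it. It has size `k + 1`, which matches the term `r (k + 1) • B (n - k)` of the
-- Wick recursion.
open Classical in
lemma sum_openNC_notMem (hm : ∀ x ∈ s, x < m) (r : ℕ → ℂ) (B : ℕ → M) :
    ∑ p ∈ openNC (insert m s) with m ∉ p.1, (∏ V ∈ p.2, r V.card) • B p.1.card =
      ∑ p ∈ openNC s, ∑ k ∈ Finset.range (p.1.card + 1),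
        (∏ V ∈ p.2, r V.card) • r (k + 1) • B (p.1.card - k) := by
  have hms : m ∉ s := fun h' => lt_irrefl _ (hm m h')
  rw [Finset.sum_sigma']
  have hblock : ∀ p ∈ (openNC (insert m s)).filter fun p => m ∉ p.1, ∃ V ∈ p.2, m ∈ V := by
    intro p hp
    obtain ⟨hp, hmp⟩ := Finset.mem_filter.1 hp
    exact (mem_openNC.1 hp).cover m (Finset.mem_insert_self _ _) hmp
  choose! blk hblk hmem using hblock
  have hdisj : ∀ p ∈ (openNC (insert m s)).filter fun p => m ∉ p.1,
      Disjoint p.1 ((blk p).erase m) := by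
    intro p hp
    have h := mem_openNC.1 (Finset.mem_filter.1 hp).1
    rw [Finset.disjoint_right]
    exact fun x hx => h.notMem_open _ (hblk p hp) x (Finset.mem_of_mem_erase hx)
  refine Finset.sum_bij
    (fun p _ => ⟨(p.1 ∪ (blk p).erase m, p.2.erase (blk p)), ((blk p).erase m).card⟩) ?_ ?_ ?_ ?_
  · intro p hp
    obtain ⟨hp', hmp⟩ := Finset.mem_filter.1 hp
    simp only [Finset.mem_sigma, mem_openNC, Finset.mem_range]
    refine ⟨(mem_openNC.1 hp').reopen hm hmp (hblk p hp) (hmem p hp), ?_⟩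
    rw [Finset.card_union_of_disjoint (hdisj p hp)]
    omega
  · intro p hp q hq hpq
    obtain ⟨hp', hmp⟩ := Finset.mem_filter.1 hp
    obtain ⟨hq', hmq⟩ := Finset.mem_filter.1 hq
    rw [Sigma.mk.injEq, heq_eq_eq, Prod.mk.injEq] at hpq
    obtain ⟨⟨h1, h2⟩, h3⟩ := hpq
    have hK : (blk p).erase m = (blk q).erase m := by
      refine upper_subset_unique h1 h3 ?_ ?_
      · exact fun x hx y hy => (mem_openNC.1 hp').lt_of_block hm hmp (hblk p hp) (hmem p hp) x hx y
          (Finset.mem_of_mem_erase hy)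
      · exact fun x hx y hy => (mem_openNC.1 hq').lt_of_block hm hmq (hblk q hq) (hmem q hq) x hx y
          (Finset.mem_of_mem_erase hy)
    have hV : blk p = blk q := by
      rw [← Finset.insert_erase (hmem p hp), hK, Finset.insert_erase (hmem q hq)]
    refine Prod.ext ?_ ?_
    · have := congrArg (· \ (blk p).erase m) h1
      rwa [Finset.union_sdiff_cancel_right (hdisj p hp), hK,
        Finset.union_sdiff_cancel_right (hdisj q hq)] at this
    · rw [← Finset.insert_erase (hblk p hp), h2, hV, Finset.insert_erase (hblk q hq)]
  · rintro ⟨⟨O, Q⟩, k⟩ hp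
    simp only [Finset.mem_sigma, mem_openNC, Finset.mem_range] at hp
    obtain ⟨h, hk⟩ := hp
    obtain ⟨K, hK, hc, hlt⟩ := exists_upper_subset O (Nat.lt_succ_iff.1 hk)
    have hmK : m ∉ K := fun h' => hms (h.open_subset (hK h'))
    have hmO : m ∉ O \ K := fun h' => hms (h.open_subset (Finset.mem_sdiff.1 h').1)
    have hclose := h.close hm hK hlt
    have hp : (O \ K, insert (insert m K) Q) ∈
        (openNC (insert m s)).filter fun p => m ∉ p.1 :=
      Finset.mem_filter.2 ⟨mem_openNC.2 hclose, hmO⟩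
    have hb : blk (O \ K, insert (insert m K) Q) = insert m K :=
      hclose.eq_of_mem _ (hblk _ hp) _ (Finset.mem_insert_self _ _) m (hmem _ hp)
        (Finset.mem_insert_self _ _)
    have hQ : insert m K ∉ Q := fun h' => hms (h.subset _ h' (Finset.mem_insert_self _ _))
    refine ⟨_, hp, ?_⟩
    simp only [hb, Finset.erase_insert hmK, Finset.erase_insert hQ, hc,
      Finset.sdiff_union_of_subset hK]
  · intro p hp
    have hc : ((blk p).erase m).card + 1 = (blk p).card := Finset.card_erase_add_one (hmem p hp)
    simp only [Finset.card_union_of_disjoint (hdisj p hp), Nat.add_sub_cancel, hc]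
    rw [smul_smul, Finset.prod_erase_mul _ _ (hblk p hp)]

end OpenPartitions

/-! ### Wick polynomials and the moment-cumulant formula -/

section Wick

variable {A : Type*} [Ring A] [Algebra ℂ A]

/-- Each further factor `x` is a new largest point: by the recursion `hB` it either stays open or
closes a block with the last `k` open points. A general `s` is used so that the induction can add a
maximum. -/
theorem pow_card_eq_sum_openNC {α : Type*} [LinearOrder α] {r : ℕ → ℂ} {B : ℕ → A} {x : A}
    (h0 : B 0 = 1)
    (hB : ∀ n, x * B n = B (n + 1) + ∑ k ∈ Finset.range (n + 1), r (k + 1) • B (n - k))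
    (s : Finset α) :
    x ^ s.card = ∑ p ∈ openNC s, (∏ V ∈ p.2, r V.card) • B p.1.card := by
  classical
  induction s using Finset.induction_on_max with
  | empty => simp [openNC_empty, h0]
  | insert m s hm ih =>
    have hms : m ∉ s := fun h' => lt_irrefl _ (hm m h')
    rw [Finset.card_insert_of_notMem hms, pow_succ', ih, Finset.mul_sum,
      ← Finset.sum_filter_add_sum_filter_not (openNC (insert m s)) (fun p => m ∈ p.1),
      sum_openNC_mem hm (fun Q => ∏ V ∈ Q, r V.card) B, sum_openNC_notMem hm,
      ← Finset.sum_add_distrib]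
    refine Finset.sum_congr rfl fun p _ => ?_
    rw [mul_smul_comm, hB, smul_add, Finset.smul_sum]

open Classical in
lemma sum_openNC_filter_eq_empty (r : ℕ → ℂ) (n : ℕ) :
    ∑ p ∈ openNC (Finset.univ : Finset (Fin n)) with p.1 = ∅, ∏ V ∈ p.2, r V.card =
      ∑ P ∈ NC n, ∏ V ∈ P.parts, r V.card := by
  symm
  refine Finset.sum_bij (fun P _ => (∅, P.parts)) ?_ ?_ ?_ ?_
  · intro P hP
    have hP' : IsNonCrossing P := (Finset.mem_filter.1 hP).2
    refine Finset.mem_filter.2 ⟨mem_openNC.2 ?_, rfl⟩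
    refine ⟨by simp, by simp, fun V hV => P.nonempty_of_mem_parts hV, by simp,
      fun U hU V hV x hx hx' => P.eq_of_mem_parts hU hV hx hx', fun x hx _ => P.exists_mem hx,
      hP', by simp⟩
  · intro P _ Q _ h
    exact Finpartition.ext (Prod.ext_iff.1 h).2
  · rintro ⟨O, Q⟩ hp
    obtain ⟨hp, hO⟩ := Finset.mem_filter.1 hp
    simp only at hO
    subst hO
    have h := mem_openNC.1 hp
    simp only at h
    refine ⟨Finpartition.ofExistsUnique Q (fun V hV => h.subset V hV) ?_ ?_, ?_, rfl⟩
    · intro x hx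
      obtain ⟨V, hV, hxV⟩ := h.cover x hx (by simp)
      exact ⟨V, ⟨hV, hxV⟩, fun U hU => h.eq_of_mem U hU.1 V hV x hU.2 hxV⟩
    · intro he
      exact Finset.not_nonempty_empty (h.nonempty _ he)
    · exact Finset.mem_filter.2 ⟨Finset.mem_univ _, h.noncrossing⟩
  · intro P _
    rfl

open Classical in
lemma map_pow_eq_sum_NC_add {r : ℕ → ℂ} {B : ℕ → A} {x : A} (ψ : A →ₗ[ℂ] ℂ) (hψ : ψ 1 = 1)
    (h0 : B 0 = 1)
    (hB : ∀ n, x * B n = B (n + 1) + ∑ k ∈ Finset.range (n + 1), r (k + 1) • B (n - k)) (n : ℕ) :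
    ψ (x ^ n) = ∑ P ∈ NC n, ∏ V ∈ P.parts, r V.card +
      ∑ p ∈ openNC (Finset.univ : Finset (Fin n)) with p.1 ≠ ∅,
        (∏ V ∈ p.2, r V.card) * ψ (B p.1.card) := by
  have h := pow_card_eq_sum_openNC h0 hB (Finset.univ : Finset (Fin n))
  rw [Finset.card_univ, Fintype.card_fin] at h
  rw [h, map_sum, ← Finset.sum_filter_add_sum_filter_not _ (fun p => p.1 = ∅),
    ← sum_openNC_filter_eq_empty]
  congr 1
  · refine Finset.sum_congr rfl fun p hp => ?_
    simp [(Finset.mem_filter.1 hp).2, h0, hψ]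
  · refine Finset.sum_congr rfl fun p hp => ?_
    simp

/-- If the Wick polynomials `B n`, `n ≥ 1`, of `x` are centered, then the moments of `x` are given
by the moment-cumulant formula. -/
theorem map_pow_eq_sum_NC {r : ℕ → ℂ} {B : ℕ → A} {x : A} (ψ : A →ₗ[ℂ] ℂ) (hψ : ψ 1 = 1)
    (h0 : B 0 = 1)
    (hB : ∀ n, x * B n = B (n + 1) + ∑ k ∈ Finset.range (n + 1), r (k + 1) • B (n - k))
    (hc : ∀ n, n ≠ 0 → ψ (B n) = 0) (n : ℕ) :
    ψ (x ^ n) = ∑ P ∈ NC n, ∏ V ∈ P.parts, r V.card := by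
  rw [map_pow_eq_sum_NC_add ψ hψ h0 hB, add_eq_left]
  refine Finset.sum_eq_zero fun p hp => ?_
  rw [hc _ (by simpa using (Finset.mem_filter.1 hp).2), mul_zero]

/-- The converse of `map_pow_eq_sum_NC`. -/
theorem map_wick_eq_zero {r : ℕ → ℂ} {B : ℕ → A} {x : A} (ψ : A →ₗ[ℂ] ℂ) (hψ : ψ 1 = 1)
    (h0 : B 0 = 1)
    (hB : ∀ n, x * B n = B (n + 1) + ∑ k ∈ Finset.range (n + 1), r (k + 1) • B (n - k))
    (hm : ∀ n, n ≠ 0 → ψ (x ^ n) = ∑ P ∈ NC n, ∏ V ∈ P.parts, r V.card) (n : ℕ) (hn : n ≠ 0) :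
    ψ (B n) = 0 := by
  induction n using Nat.strong_induction_on with
  | _ n ih =>
    have h := map_pow_eq_sum_NC_add ψ hψ h0 hB n
    -- The configuration with every point open has weight 1 and contributes `ψ (B n)`; all others
    -- have fewer open points and vanish by induction.
    rw [hm n hn, left_eq_add, Finset.sum_eq_single (Finset.univ, ∅)] at h
    · simpa using h
    · rintro ⟨O, Q⟩ hp hne
      obtain ⟨hp, hO⟩ := Finset.mem_filter.1 hp
      have hOQ := mem_openNC.1 hp
      simp only at hO hOQ
      have hO' : O ≠ Finset.univ := by
        rintro rfl
        refine hne (Prod.ext rfl (Finset.eq_empty_of_forall_notMem fun V hV => ?_))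
        obtain ⟨x, hx⟩ := hOQ.nonempty V hV
        exact hOQ.notMem_open V hV x hx (Finset.mem_univ x)
      have hlt : O.card < n := by
        simpa using Finset.card_lt_card (Finset.ssubset_univ_iff.2 hO')
      simp only
      rw [ih _ hlt (by simpa using hO), mul_zero]
    · intro h'
      exfalso
      refine h' (Finset.mem_filter.2 ⟨mem_openNC.2 ?_, ?_⟩)
      · constructor <;> simp
      · have : NeZero n := ⟨hn⟩
        exact Finset.univ_nonempty.ne_empty

lemma moment_const (ψ : A →ₗ[ℂ] ℂ) (n : ℕ) (x : A) : moment ψ (fun _ : Fin n => x) = ψ (x ^ n) := by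
  simp [moment]

lemma map_pow_eq_sum_freeCumulantOf (ψ : A →ₗ[ℂ] ℂ) (x : A) (n : ℕ) (hn : n ≠ 0) :
    ψ (x ^ n) = ∑ P ∈ NC n, ∏ V ∈ P.parts, freeCumulantOf ψ V.card x := by
  rw [← moment_const, moment_eq_sum_freeCumulant ψ hn]
  rfl

/-- The free cumulants are determined by the moment-cumulant formula. -/
theorem freeCumulantOf_eq_of_map_pow (ψ : A →ₗ[ℂ] ℂ) (x : A) {r : ℕ → ℂ}
    (hm : ∀ n, n ≠ 0 → ψ (x ^ n) = ∑ P ∈ NC n, ∏ V ∈ P.parts, r V.card) (n : ℕ) (hn : n ≠ 0) :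
    freeCumulantOf ψ n x = r n := by
  induction n using Nat.strong_induction_on with
  | _ n ih =>
    have h1 := map_pow_eq_sum_freeCumulantOf ψ x n hn
    rw [hm n hn, sum_NC hn, sum_NC hn] at h1
    have hb : (oneBlock n hn).parts = {Finset.univ} := rfl
    simp only [hb, Finset.prod_singleton, Finset.card_univ, Fintype.card_fin] at h1
    have h2 : ∑ P ∈ properNC n, ∏ V ∈ P.parts, freeCumulantOf ψ V.card x =
        ∑ P ∈ properNC n, ∏ V ∈ P.parts, r V.card := by
      refine Finset.sum_congr rfl fun P hP => Finset.prod_congr rfl fun V hV => ?_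
      exact ih _ ((Finset.mem_filter.1 hP).2 V hV) (P.nonempty_of_mem_parts hV).card_pos.ne'
    rw [h2] at h1
    exact (add_right_cancel h1).symm

end Wick


/-! ### Additivity of free cumulants -/

section WickSeries

variable {A : Type*} [Ring A] [Algebra ℂ A]

/-- The power series `1 + ∑ r_k z^k - x z`, whose inverse is the generating function of the Wick
polynomials of `x`. -/
def wickInv (r : ℕ → ℂ) (x : A) : PowerSeries A :=
  1 + PowerSeries.X * (PowerSeries.mk (fun k => algebraMap ℂ A (r (k + 1))) - PowerSeries.C x)

/-- The generating function of the Wick polynomials of `x`. -/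
def wickSeries (r : ℕ → ℂ) (x : A) : PowerSeries A := (wickInv r x).invOfUnit 1

lemma constantCoeff_wickInv (r : ℕ → ℂ) (x : A) :
    PowerSeries.constantCoeff (wickInv r x) = 1 := by
  simp [wickInv]

lemma wickInv_mul_wickSeries (r : ℕ → ℂ) (x : A) : wickInv r x * wickSeries r x = 1 :=
  PowerSeries.mul_invOfUnit _ _ (by simp [constantCoeff_wickInv])

lemma wickSeries_mul_wickInv (r : ℕ → ℂ) (x : A) : wickSeries r x * wickInv r x = 1 :=
  PowerSeries.invOfUnit_mul _ _ (by simp [constantCoeff_wickInv])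

lemma constantCoeff_wickSeries (r : ℕ → ℂ) (x : A) :
    PowerSeries.constantCoeff (wickSeries r x) = 1 := by
  simp [wickSeries]

/-- The inverse generating function is affine in the pair `(r, x)`, which is why adding variables
goes with adding cumulants. -/
lemma wickInv_add (r s : ℕ → ℂ) (x y : A) :
    wickInv (r + s) (x + y) = wickInv r x + wickInv s y - 1 := by
  have : (PowerSeries.mk fun k => algebraMap ℂ A ((r + s) (k + 1))) =
      (PowerSeries.mk fun k => algebraMap ℂ A (r (k + 1))) +
        PowerSeries.mk fun k => algebraMap ℂ A (s (k + 1)) := by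
    ext n
    simp
  rw [wickInv, wickInv, wickInv, this, map_add]
  noncomm_ring

/-- The Wick polynomials of `x`. -/
def wick (r : ℕ → ℂ) (x : A) (n : ℕ) : A := PowerSeries.coeff n (wickSeries r x)

lemma wick_zero (r : ℕ → ℂ) (x : A) : wick r x 0 = 1 := by
  simp [wick, constantCoeff_wickSeries]

lemma mul_wick (r : ℕ → ℂ) (x : A) (n : ℕ) :
    x * wick r x n =
      wick r x (n + 1) + ∑ k ∈ Finset.range (n + 1), r (k + 1) • wick r x (n - k) := by
  have h := congrArg (PowerSeries.coeff (n + 1)) (wickInv_mul_wickSeries r x)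
  rw [wickInv, add_mul, one_mul, mul_assoc, map_add, PowerSeries.coeff_succ_X_mul, sub_mul, map_sub,
    PowerSeries.coeff_C_mul, PowerSeries.coeff_mul, PowerSeries.coeff_one, if_neg n.succ_ne_zero,
    Finset.Nat.sum_antidiagonal_eq_sum_range_succ_mk] at h
  simp only [PowerSeries.coeff_mk, ← Algebra.smul_def] at h
  rw [← add_sub_assoc, sub_eq_zero] at h
  exact h.symm

lemma wick_mem (r : ℕ → ℂ) {x : A} {B : Subalgebra ℂ A} (hx : x ∈ B) (n : ℕ) : wick r x n ∈ B := by
  induction n using Nat.strong_induction_on with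
  | _ n ih =>
    cases n with
    | zero => rw [wick_zero]; exact one_mem B
    | succ n =>
      rw [← sub_eq_of_eq_add (mul_wick r x n)]
      refine sub_mem (mul_mem hx (ih n n.lt_succ_self)) (sum_mem fun k _ => ?_)
      exact Subalgebra.smul_mem _ (ih _ (by omega)) _

end WickSeries

/-! ### Alternating words and additivity for free elements -/

section Freeness

variable {A : Type*} [Ring A] [Algebra ℂ A]

/-- `z` is an alternating product of centered elements of the algebras `B i`, whose first factor
is in `B i`. -/
inductive IsAlternating (ψ : A →ₗ[ℂ] ℂ) {ι : Type*} (B : ι → Subalgebra ℂ A) : ι → A → Prop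
  | single {i : ι} {a : A} (ha : a ∈ B i) (h0 : ψ a = 0) : IsAlternating ψ B i a
  | mul {i j : ι} {a z : A} (ha : a ∈ B i) (h0 : ψ a = 0) (hij : i ≠ j)
      (hz : IsAlternating ψ B j z) : IsAlternating ψ B i (a * z)

variable {φ ψ : A →ₗ[ℂ] ℂ} {ι : Type*} {B : ι → Subalgebra ℂ A}

lemma IsAlternating.exists_word {i : ι} {z : A} (h : IsAlternating ψ B i z) :
    ∃ (n : ℕ) (c : Fin (n + 1) → ι) (a : Fin (n + 1) → A), c 0 = i ∧ (∀ j, a j ∈ B (c j)) ∧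
      (∀ j : Fin n, c j.castSucc ≠ c j.succ) ∧ (∀ j, ψ (a j) = 0) ∧ (List.ofFn a).prod = z := by
  induction h with
  | @single i a ha h0 =>
    exact ⟨0, fun _ => i, fun _ => a, rfl, fun _ => ha, fun j => j.elim0, fun _ => h0, by simp⟩
  | @mul i j a z ha h0 hij _ ih =>
    obtain ⟨n, c, b, hc0, hb, hc, hb0, rfl⟩ := ih
    refine ⟨n + 1, Fin.cons i c, Fin.cons a b, rfl, ?_, ?_, ?_, ?_⟩
    · intro k
      refine Fin.cases ?_ (fun k => ?_) k
      · simpa using ha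
      · simpa using hb k
    · intro k
      refine Fin.cases ?_ (fun k => ?_) k
      · simpa [hc0] using hij
      · rw [← Fin.succ_castSucc]
        simpa using hc k
    · intro k
      refine Fin.cases ?_ (fun k => ?_) k
      · simpa using h0
      · simpa using hb0 k
    · rw [List.ofFn_succ]
      simp

lemma IsTwoStateFree.map_eq_zero [StarRing A] (hB : IsTwoStateFree φ ψ B) {i : ι} {z : A}
    (hz : z ∈ Submodule.span ℂ {z | IsAlternating ψ B i z}) : ψ z = 0 := by
  suffices h : Submodule.span ℂ {z | IsAlternating ψ B i z} ≤ LinearMap.ker ψ from h hz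
  rw [Submodule.span_le]
  intro z hz
  obtain ⟨n, c, a, -, ha, hc, ha0, rfl⟩ := IsAlternating.exists_word hz
  exact (hB n c a ha hc ha0).1

lemma mul_mem_span_isAlternating {i j : ι} (hij : i ≠ j) {a z : A} (ha : a ∈ B i) (h0 : ψ a = 0)
    (hz : z ∈ Submodule.span ℂ {z | IsAlternating ψ B j z}) :
    a * z ∈ Submodule.span ℂ {z | IsAlternating ψ B i z} := by
  suffices h : Submodule.span ℂ {z | IsAlternating ψ B j z} ≤
      (Submodule.span ℂ {z | IsAlternating ψ B i z}).comap (LinearMap.mulLeft ℂ a) from h hz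
  rw [Submodule.span_le]
  exact fun z hz => Submodule.subset_span (IsAlternating.mul ha h0 hij hz)

/-- If `F = 1 + (P - 1) G`, where the higher coefficients of `P` are centered elements of `B i`,
then the `n`-th coefficient of `F` is alternating as soon as the lower coefficients of `G` are. -/
lemma coeff_mem_span_isAlternating {i j : ι} (hij : i ≠ j) {P F G : PowerSeries A}
    (hP0 : PowerSeries.constantCoeff P = 1) (hG0 : PowerSeries.constantCoeff G = 1)
    (hP : ∀ n, n ≠ 0 → PowerSeries.coeff n P ∈ B i ∧ ψ (PowerSeries.coeff n P) = 0)
    (hF : F - 1 = (P - 1) * G) {n : ℕ} (hn : n ≠ 0)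
    (hG : ∀ k < n, k ≠ 0 →
      PowerSeries.coeff k G ∈ Submodule.span ℂ {z | IsAlternating ψ B j z}) :
    PowerSeries.coeff n F ∈ Submodule.span ℂ {z | IsAlternating ψ B i z} := by
  have h := congrArg (PowerSeries.coeff n) hF
  rw [map_sub, PowerSeries.coeff_one, if_neg hn, sub_zero, PowerSeries.coeff_mul] at h
  rw [h]
  -- `P - 1` has no constant term, so only coefficients of `G` of degree below `n` enter. Degree 0
  -- of `G` gives a one-letter word; the others are prefixed by a letter from `B i`.
  refine sum_mem fun p hp => ?_
  rw [Finset.HasAntidiagonal.mem_antidiagonal] at hp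
  rcases eq_or_ne p.1 0 with h1 | h1
  · simp [h1, hP0]
  · have hc : PowerSeries.coeff p.1 (P - 1) = PowerSeries.coeff p.1 P := by
      rw [map_sub, PowerSeries.coeff_one, if_neg h1, sub_zero]
    rw [hc]
    obtain ⟨hm, h0⟩ := hP _ h1
    rcases eq_or_ne p.2 0 with h2 | h2
    · rw [h2, PowerSeries.coeff_zero_eq_constantCoeff_apply, hG0, mul_one]
      exact Submodule.subset_span (IsAlternating.single hm h0)
    · exact mul_mem_span_isAlternating hij hm h0 (hG _ (by omega) h2)

lemma map_wick_freeCumulantOf (hψ : ψ 1 = 1) (x : A) (n : ℕ) (hn : n ≠ 0) :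
    ψ (wick (fun k => freeCumulantOf ψ k x) x n) = 0 :=
  map_wick_eq_zero ψ hψ (wick_zero _ _) (mul_wick _ _)
    (fun n hn => map_pow_eq_sum_freeCumulantOf ψ x n hn) n hn

/-- Free cumulants are additive on free elements. -/
theorem IsTwoStateFree.freeCumulantOf_add [StarRing A] (hB : IsTwoStateFree φ ψ B)
    (hψ : ψ 1 = 1) {i j : ι} (hij : i ≠ j) {x y : A} (hx : x ∈ B i) (hy : y ∈ B j) (n : ℕ) (hn : n ≠ 0) :
    freeCumulantOf ψ n (x + y) = freeCumulantOf ψ n x + freeCumulantOf ψ n y := by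
  set r : ℕ → ℂ := fun k => freeCumulantOf ψ k x with hr
  set s : ℕ → ℂ := fun k => freeCumulantOf ψ k y with hs
  set P := wickSeries r x with hPdef
  set Q := wickSeries s y with hQdef
  set U := wickSeries (r + s) (x + y) with hUdef
  -- `F` collects the words starting in `B i` and `G` those starting in `B j`. As `U = P * G = Q *
  -- F` and `F + G = U + 1`, each of `F` and `G` is obtained from the other by prefixing a letter.
  set F := wickInv s y * U with hFdef
  set G := wickInv r x * U with hGdef
  have hPG : P * G = U := by rw [hGdef, ← mul_assoc, wickSeries_mul_wickInv, one_mul]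
  have hQF : Q * F = U := by rw [hFdef, ← mul_assoc, wickSeries_mul_wickInv, one_mul]
  have hFG : F + G = U + 1 := by
    have h := wickInv_mul_wickSeries (r + s) (x + y)
    rw [wickInv_add, ← hUdef, sub_mul, add_mul, one_mul, sub_eq_iff_eq_add] at h
    rw [add_comm F G, h, add_comm]
  have hF : F - 1 = (P - 1) * G := by
    rw [sub_mul, hPG, one_mul, sub_eq_sub_iff_add_eq_add, hFG]
  have hG : G - 1 = (Q - 1) * F := by
    rw [sub_mul, hQF, one_mul, sub_eq_sub_iff_add_eq_add, add_comm, hFG]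
  have hF0 : PowerSeries.constantCoeff F = 1 := by
    rw [hFdef, map_mul, constantCoeff_wickInv, constantCoeff_wickSeries, one_mul]
  have hG0 : PowerSeries.constantCoeff G = 1 := by
    rw [hGdef, map_mul, constantCoeff_wickInv, constantCoeff_wickSeries, one_mul]
  have key : ∀ n, n ≠ 0 →
      PowerSeries.coeff n F ∈ Submodule.span ℂ {z | IsAlternating ψ B i z} ∧
        PowerSeries.coeff n G ∈ Submodule.span ℂ {z | IsAlternating ψ B j z} := by
    intro n
    induction n using Nat.strong_induction_on with
    | _ n ih =>
      intro hn
      exact ⟨coeff_mem_span_isAlternating hij (constantCoeff_wickSeries _ _) hG0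
          (fun n hn => ⟨wick_mem r hx n, map_wick_freeCumulantOf hψ x n hn⟩) hF hn
          fun k hk hk0 => (ih k hk hk0).2,
        coeff_mem_span_isAlternating hij.symm (constantCoeff_wickSeries _ _) hF0
          (fun n hn => ⟨wick_mem s hy n, map_wick_freeCumulantOf hψ y n hn⟩) hG hn
          fun k hk hk0 => (ih k hk hk0).1⟩
  have hU : ∀ n, n ≠ 0 → ψ (wick (r + s) (x + y) n) = 0 := by
    intro n hn
    have h := congrArg (PowerSeries.coeff n) hFG
    rw [map_add, map_add, PowerSeries.coeff_one, if_neg hn, add_zero] at h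
    rw [wick, ← hUdef, ← h, map_add, hB.map_eq_zero (key n hn).1, hB.map_eq_zero (key n hn).2,
      add_zero]
  exact freeCumulantOf_eq_of_map_pow ψ (x + y) (r := r + s)
    (fun n _ => map_pow_eq_sum_NC ψ hψ (wick_zero _ _) (mul_wick _ _) hU n) n hn

end Freeness


/-! ### Cumulants of the process -/

section LowOrder

variable {A : Type*} [Ring A] [Algebra ℂ A]

lemma freeCumulantOf_congr {ψ : A →ₗ[ℂ] ℂ} {x y : A} (h : ∀ n, ψ (x ^ n) = ψ (y ^ n)) (n : ℕ) (hn : n ≠ 0) :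
    freeCumulantOf ψ n x = freeCumulantOf ψ n y :=
  freeCumulantOf_eq_of_map_pow ψ x (r := fun k => freeCumulantOf ψ k y)
    (fun n hn => by rw [h n, map_pow_eq_sum_freeCumulantOf ψ y n hn]) n hn

lemma twoStateCumulantOf_one (φ ψ : A →ₗ[ℂ] ℂ) (x : A) : twoStateCumulantOf φ ψ 1 x = φ x := by
  have h : properNC 1 = ∅ := by
    refine Finset.eq_empty_of_forall_notMem fun P hP => ?_
    obtain ⟨V, hV, -⟩ := P.exists_mem (Finset.mem_univ 0)
    have := (Finset.mem_filter.1 hP).2 V hV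
    have := (P.nonempty_of_mem_parts hV).card_pos
    omega
  rw [twoStateCumulantOf, twoStateCumulant, h, Finset.sum_empty, sub_zero, moment_const, pow_one]

lemma twoStateCumulantOf_two (φ ψ : A →ₗ[ℂ] ℂ) {x : A} (hx : φ x = 0) :
    twoStateCumulantOf φ ψ 2 x = φ (x ^ 2) := by
  rw [twoStateCumulantOf, twoStateCumulant, moment_const, sub_eq_self]
  refine Finset.sum_eq_zero fun P hP => ?_
  obtain ⟨V, hV, -⟩ := P.exists_mem (Finset.mem_univ 0)
  have hcard : ∀ U ∈ P.parts, U.card = 1 := fun U hU => by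
    have := (Finset.mem_filter.1 hP).2 U hU
    have := (P.nonempty_of_mem_parts hU).card_pos
    omega
  refine Finset.prod_eq_zero hV ?_
  have hin : ¬ IsInner P V := by
    rintro ⟨U, hU, y₁, h₁, y₂, h₂, h⟩
    obtain ⟨z, hz⟩ := P.nonempty_of_mem_parts hV
    have he := Finset.card_le_one.1 (hcard U hU).le y₁ h₁ y₂ h₂
    exact lt_irrefl y₁ ((h z hz).1.trans (he ▸ (h z hz).2))
  rw [if_neg hin, dif_pos ((Finset.mem_filter.1 hP).2 V hV)]
  change twoStateCumulantOf φ ψ V.card x = 0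
  rw [hcard V hV, twoStateCumulantOf_one, hx]

end LowOrder

/-! ### Cumulants as functions of time and their small-increment limit -/

section Increments

variable {A : Type*} [Ring A] [StarRing A] [Algebra ℂ A]
variable {φ ψ : A →ₗ[ℂ] ℂ} {T : ℝ} {X : ℝ → A}

/-- The free cumulants of a process with stationary free increments are additive in time. -/
lemma HasTwoStateFreeIncrements.freeCumulantOf_add (hX : HasTwoStateFreeIncrements φ ψ T X)
    (hψ : ψ 1 = 1) {s t : ℝ} (hs : 0 ≤ s) (ht : 0 ≤ t) (hst : s + t ≤ T) (n : ℕ) (hn : n ≠ 0) :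
    freeCumulantOf ψ n (X (s + t)) = freeCumulantOf ψ n (X s) + freeCumulantOf ψ n (X t) := by
  have hfree := hX.free 2 ![0, s] ![s, s + t]
    (by
      intro i
      fin_cases i
      · exact ⟨le_rfl, hs, by simpa using by linarith⟩
      · exact ⟨hs, by simpa using ht, hst⟩)
    (by
      have h : Disjoint (Set.Ico 0 s) (Set.Ico s (s + t)) :=
        Set.disjoint_left.2 fun u hu hu' => not_lt.2 hu'.1 hu.2
      intro i j hij
      fin_cases i <;> fin_cases j
      · exact absurd rfl hij
      · exact h
      · exact h.symm
      · exact absurd rfl hij)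
  have h := hfree.freeCumulantOf_add hψ (i := 0) (j := 1) (by decide)
    (Algebra.self_mem_adjoin_singleton ℂ _) (Algebra.self_mem_adjoin_singleton ℂ _) n hn
  have hstat : freeCumulantOf ψ n (X (s + t) - X s) = freeCumulantOf ψ n (X t) := by
    refine freeCumulantOf_congr (fun k => ?_) n hn
    have := (hX.stationary 0 t s le_rfl ht hs (by linarith) k).2
    rwa [zero_add, hX.zero, sub_zero, add_comm t s] at this
  simpa [hX.zero, hstat] using h

lemma HasTwoStateFreeIncrements.freeCumulantOf_nat_mul (hX : HasTwoStateFreeIncrements φ ψ T X)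
    (hψ : ψ 1 = 1) {u : ℝ} (hu : 0 ≤ u) (n : ℕ) (hn : n ≠ 0) (j : ℕ) (hj : j * u ≤ T) :
    freeCumulantOf ψ n (X (j * u)) = j * freeCumulantOf ψ n (X u) := by
  induction j with
  | zero =>
    have h := hX.freeCumulantOf_add hψ le_rfl le_rfl (by simpa using hj) n hn
    simpa using h
  | succ j ih =>
    push_cast at hj ⊢
    rw [add_mul, one_mul] at hj ⊢
    rw [hX.freeCumulantOf_add hψ (by positivity) hu hj n hn, ih (by linarith)]
    ring

/-- Infinite divisibility: `X T` is a sum of `N` free increments, each distributed under `ψ` like `X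
(T / N)`. -/
lemma HasTwoStateFreeIncrements.freeCumulantOf_div (hX : HasTwoStateFreeIncrements φ ψ T X)
    (hψ : ψ 1 = 1) (hT : 0 < T) (n : ℕ) (hn : n ≠ 0) {N : ℕ} (hN : N ≠ 0) :
    freeCumulantOf ψ n (X (T / N)) = freeCumulantOf ψ n (X T) / N := by
  have hN' : (N : ℝ) ≠ 0 := by exact_mod_cast hN
  have hNc : (N : ℂ) ≠ 0 := by exact_mod_cast hN
  have h := hX.freeCumulantOf_nat_mul hψ (u := T / N) (by positivity) n hn N
    (by rw [mul_div_cancel₀ _ hN'])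
  rw [mul_div_cancel₀ _ hN'] at h
  rw [h, mul_div_cancel_left₀ _ hNc]

lemma HasTwoStateFreeIncrements.map_variationSum (hX : HasTwoStateFreeIncrements φ ψ T X)
    (hT : 0 < T) (k : ℕ) {N : ℕ} (hN : N ≠ 0) :
    ψ (variationSum T X k N) = N * ψ (X (T / N) ^ k) := by
  have hN' : (0 : ℝ) < N := by exact_mod_cast Nat.pos_of_ne_zero hN
  rw [variationSum, map_sum, Finset.sum_congr rfl (g := fun _ => ψ (X (T / N) ^ k))]
  · simp
  · intro i hi
    have hi' : (i : ℝ) + 1 ≤ N := by exact_mod_cast Finset.mem_range.1 hi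
    have e1 : ((i : ℝ) + 1) / N * T = T / N + i / N * T := by ring
    have h := (hX.stationary 0 (T / N) (i / N * T) le_rfl (by positivity) (by positivity) (by
      rw [← e1]
      exact mul_le_of_le_one_left hT.le ((div_le_one hN').2 hi')) k).2
    rwa [zero_add, hX.zero, sub_zero, ← e1] at h

lemma two_le_card_parts_of_mem_properNC {n : ℕ} (hn : n ≠ 0)
    {P : Finpartition (Finset.univ : Finset (Fin n))} (hP : P ∈ properNC n) :
    2 ≤ P.parts.card := by
  by_contra hlt
  have : NeZero n := ⟨hn⟩
  have h1 : P.parts.card = 1 := by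
    have : 0 < P.parts.card :=
      Finset.card_pos.2 (P.parts_nonempty Finset.univ_nonempty.ne_empty)
    omega
  obtain ⟨V, hV⟩ := Finset.card_eq_one.1 h1
  have hVc := (Finset.mem_filter.1 hP).2 V (by simp [hV])
  have hsum := P.sum_card_parts
  rw [hV, Finset.sum_singleton, Finset.card_univ, Fintype.card_fin] at hsum
  omega

/-- `N ψ[X(T/N)^k]` converges to the `k`-th free cumulant of `X(T)`. -/
lemma HasTwoStateFreeIncrements.tendsto_map_variationSum (hX : HasTwoStateFreeIncrements φ ψ T X)
    (hψ : ψ 1 = 1) (hT : 0 < T) (k : ℕ) (hk : k ≠ 0) :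
    Tendsto (fun N : ℕ => ψ (variationSum T X k N)) atTop (𝓝 (freeCumulantOf ψ k (X T))) := by
  -- Every block carries a factor `1 / N`, and one of these cancels against the `N` summands. A
  -- proper partition has at least two blocks, so a positive power of `1 / N` is left.
  have hlim : Tendsto (fun N : ℕ => freeCumulantOf ψ k (X T) +
      ∑ P ∈ properNC k, (∏ V ∈ P.parts, freeCumulantOf ψ V.card (X T)) *
        ((N : ℂ)⁻¹) ^ (P.parts.card - 1)) atTop (𝓝 (freeCumulantOf ψ k (X T))) := by
    have hinv : Tendsto (fun N : ℕ => (N : ℂ)⁻¹) atTop (𝓝 0) :=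
      tendsto_inv_atTop_nhds_zero_nat
    have h0 : Tendsto (fun N : ℕ =>
        ∑ P ∈ properNC k, (∏ V ∈ P.parts, freeCumulantOf ψ V.card (X T)) *
          ((N : ℂ)⁻¹) ^ (P.parts.card - 1)) atTop (𝓝 (∑ P ∈ properNC k, 0)) := by
      refine tendsto_finsetSum _ fun P hP => ?_
      have h2 := two_le_card_parts_of_mem_properNC hk hP
      have h := (hinv.pow (P.parts.card - 1)).const_mul
        (∏ V ∈ P.parts, freeCumulantOf ψ V.card (X T))
      rwa [zero_pow (by omega), mul_zero] at h
    simpa using h0.const_add (freeCumulantOf ψ k (X T))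
  refine hlim.congr' ?_
  filter_upwards [eventually_ne_atTop 0] with N hN
  have hNc : (N : ℂ) ≠ 0 := by exact_mod_cast hN
  have hterm : ∀ P : Finpartition (Finset.univ : Finset (Fin k)),
      ∏ V ∈ P.parts, freeCumulantOf ψ V.card (X (T / N)) =
        (∏ V ∈ P.parts, freeCumulantOf ψ V.card (X T)) * ((N : ℂ)⁻¹) ^ P.parts.card := by
    intro P
    rw [← Finset.prod_const, ← Finset.prod_mul_distrib]
    refine Finset.prod_congr rfl fun V hV => ?_
    rw [hX.freeCumulantOf_div hψ hT _ (P.nonempty_of_mem_parts hV).card_pos.ne' hN, div_eq_mul_inv]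
  have hb : (oneBlock k hk).parts = {Finset.univ} := rfl
  rw [hX.map_variationSum hT k hN, map_pow_eq_sum_freeCumulantOf ψ _ k hk, sum_NC hk, mul_add,
    Finset.mul_sum]
  congr 1
  · rw [hb, Finset.prod_singleton, Finset.card_univ, Fintype.card_fin,
      hX.freeCumulantOf_div hψ hT k hk hN, mul_div_cancel₀ _ hNc]
  · refine Finset.sum_congr rfl fun P hP => ?_
    have h2 := two_le_card_parts_of_mem_properNC hk hP
    obtain ⟨c, hc⟩ : ∃ c, P.parts.card = c + 1 := ⟨P.parts.card - 1, by omega⟩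
    rw [hterm, hc, Nat.add_sub_cancel, pow_succ]
    field_simp

/-- A nonnegative additive function on `[0, T]` is linear. -/
lemma eq_div_mul_of_add_of_nonneg {f : ℝ → ℝ} {T : ℝ} (hT : 0 < T)
    (hadd : ∀ s t, 0 ≤ s → 0 ≤ t → s + t ≤ T → f (s + t) = f s + f t)
    (hf : ∀ t ∈ Set.Icc 0 T, 0 ≤ f t) {t : ℝ} (ht : t ∈ Set.Icc 0 T) :
    f t = f T / T * t := by
  have hmono : ∀ s t, 0 ≤ s → s ≤ t → t ≤ T → f s ≤ f t := by
    intro s t hs hst htT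
    have h := hadd s (t - s) hs (by linarith) (by linarith)
    rw [add_sub_cancel] at h
    have := hf (t - s) ⟨by linarith, by linarith⟩
    linarith
  have hnat : ∀ (u : ℝ) (j : ℕ), 0 ≤ u → j * u ≤ T → f (j * u) = j * f u := by
    intro u j hu
    induction j with
    | zero =>
      intro _
      have := hadd 0 0 le_rfl le_rfl (by linarith)
      simp only [add_zero] at this
      simp only [Nat.cast_zero, zero_mul]
      linarith
    | succ j ih =>
      intro hj
      push_cast at hj ⊢
      rw [add_mul, one_mul] at hj ⊢
      rw [hadd _ _ (by positivity) hu hj, ih (by linarith)]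
      ring
  have hfT : 0 ≤ f T := hf T ⟨hT.le, le_rfl⟩
  -- Both `f t` and the linear interpolation at `t` lie between `j * (f T / N)` and `(j + 1) * (f T
  -- / N)`, where `t` is in the `j`-th cell of the mesh `T / N`.
  have hbound : ∀ N : ℕ, N ≠ 0 → |f t - f T / T * t| ≤ f T * (1 / (N : ℝ)) := by
    intro N hN
    have hN' : (0 : ℝ) < N := by exact_mod_cast Nat.pos_of_ne_zero hN
    have hu : 0 < T / N := by positivity
    have hfu : f (T / N) = f T / N := by
      have h := hnat (T / N) N hu.le (by rw [mul_div_cancel₀ _ hN'.ne'])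
      rw [mul_div_cancel₀ _ hN'.ne'] at h
      rw [h, mul_div_cancel_left₀ _ hN'.ne']
    set j := ⌊t / (T / N)⌋₊ with hj
    have h1 : j * (T / N) ≤ t :=
      (le_div_iff₀ hu).1 (Nat.floor_le (div_nonneg ht.1 hu.le))
    have h2 : t < (j + 1) * (T / N) := (div_lt_iff₀ hu).1 (Nat.lt_floor_add_one _)
    have e1 : f T / T * (j * (T / N)) = j * (f T / N) := by field_simp
    have e2 : f T / T * ((j + 1) * (T / N)) = (j + 1) * (f T / N) := by field_simp
    have hc : 0 ≤ f T / T := by positivity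
    have g1 := mul_le_mul_of_nonneg_left h1 hc
    have g2 := mul_le_mul_of_nonneg_left h2.le hc
    rw [e1] at g1
    rw [e2] at g2
    have l1 : j * (f T / N) ≤ f t := by
      rw [← hfu, ← hnat _ _ hu.le (h1.trans ht.2)]
      exact hmono _ _ (by positivity) h1 ht.2
    have l2 : f t ≤ (j + 1) * (f T / N) := by
      by_cases hle : (j + 1) * (T / N) ≤ T
      · have := hnat (T / N) (j + 1) hu.le (by exact_mod_cast hle)
        rw [hfu] at this
        push_cast at this
        rw [← this]
        exact hmono _ _ ht.1 h2.le hle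
      -- The right grid point lies beyond `T`, where additivity is not available; `f t ≤ f T` is
      -- enough.
      · have hle' := hmono t T ht.1 ht.2 le_rfl
        have : f T / T * T ≤ f T / T * ((j + 1) * (T / N)) :=
          mul_le_mul_of_nonneg_left (not_le.1 hle).le hc
        rw [e2, div_mul_cancel₀ _ hT.ne'] at this
        linarith
    rw [abs_le, mul_one_div]
    constructor <;> linarith
  have hlim : Tendsto (fun N : ℕ => f T * (1 / (N : ℝ))) atTop (𝓝 0) := by
    simpa using (tendsto_one_div_atTop_nhds_zero_nat (𝕜 := ℝ)).const_mul (f T)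
  have h0 : |f t - f T / T * t| ≤ 0 :=
    ge_of_tendsto hlim ((eventually_ne_atTop 0).mono hbound)
  exact sub_eq_zero.1 (abs_nonpos_iff.1 h0)

lemma HasTwoStateFreeIncrements.freeCumulantOf_eq_div_mul
    (hX : HasTwoStateFreeIncrements φ ψ T X) (hψ : ψ 1 = 1) (hT : 0 < T) {n : ℕ} (hn : n ≠ 0)
    (hcum : ∀ t ∈ Set.Icc 0 T, 0 ≤ freeCumulantOf ψ n (X t)) {t : ℝ} (ht : t ∈ Set.Icc 0 T) :
    freeCumulantOf ψ n (X t) = (((freeCumulantOf ψ n (X T)).re / T * t : ℝ) : ℂ) := by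
  have h := eq_div_mul_of_add_of_nonneg (f := fun t => (freeCumulantOf ψ n (X t)).re) hT
    (fun s t hs ht hst => by
      simp only [hX.freeCumulantOf_add hψ hs ht hst n hn, Complex.add_re])
    (fun t ht => (Complex.nonneg_iff.1 (hcum t ht)).1) ht
  rw [← h]
  -- Non-negativity in the order of `ℂ` includes the vanishing of the imaginary part.
  exact (Complex.ext (by simp) (by simpa using (Complex.nonneg_iff.1 (hcum t ht)).2.symm))

end Increments

/-- A state on a C⋆-algebra is norm-continuous. -/
lemma IsState.continuous {A : Type*} [CStarAlgebra A] {ψ : A →ₗ[ℂ] ℂ} (hψ : IsState ψ) :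
    Continuous ψ := by
  -- In the spectral order the positive elements are exactly those of the form `star y * y`, so `ψ`
  -- is a positive map and hence bounded.
  let _ := CStarAlgebra.spectralOrder A
  have := CStarAlgebra.spectralOrderedRing A
  let f : A →ₚ[ℂ] ℂ := PositiveLinearMap.mk₀ ψ fun x hx => by
    obtain ⟨y, rfl⟩ := CStarAlgebra.nonneg_iff_eq_star_mul_self.1 hx
    exact hψ.nonneg y
  exact map_continuous f

end TwoStateFree

end

theorem mainTheorem12 {A : Type*} [CStarAlgebra A] (φ ψ : A →ₗ[ℂ] ℂ)
    (hφ : TwoStateFree.IsState φ) (hψ : TwoStateFree.IsState ψ)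
    (hφ_faithful : TwoStateFree.IsFaithful φ)
    (T : ℝ) (hT : 0 < T) (X : ℝ → A)
    (hX : TwoStateFree.IsAlgebraicTwoStateFreeBM φ ψ T X)
    (hgen : (StarAlgebra.adjoin ℂ (X '' Set.Icc 0 T)).topologicalClosure = ⊤)
    (hcum : ∀ t ∈ Set.Icc 0 T, ∀ n : ℕ, 1 ≤ n → 0 ≤ TwoStateFree.freeCumulantOf ψ n (X t))
    (hvar : ∀ k : ℕ, 2 < k →
      Tendsto (fun N : ℕ => TwoStateFree.variationSum T X k N) atTop (𝓝 0))
    (hquad : Tendsto (fun N : ℕ => TwoStateFree.variationSum T X 2 N) atTop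
      (𝓝 (algebraMap ℂ A (T : ℂ)))) :
    ∃ α : ℝ, TwoStateFree.IsTwoStateFreeBM φ ψ T X α := by
  open TwoStateFree in
  have hI := hX.toHasTwoStateFreeIncrements
  have hψ1 := hψ.map_one
  have h2 : freeCumulantOf ψ 2 (X T) = T := by
    refine tendsto_nhds_unique (hI.tendsto_map_variationSum hψ1 hT 2 two_ne_zero) ?_
    have h := (hψ.continuous.tendsto _).comp hquad
    rwa [Algebra.algebraMap_eq_smul_one, map_smul, hψ1, smul_eq_mul, mul_one] at h
  have hk : ∀ k, 2 < k → freeCumulantOf ψ k (X T) = 0 := by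
    intro k hk
    refine tendsto_nhds_unique (hI.tendsto_map_variationSum hψ1 hT k (by omega)) ?_
    have h := (hψ.continuous.tendsto _).comp (hvar k hk)
    rwa [map_zero] at h
  have hlin : ∀ k, k ≠ 0 → ∀ t ∈ Set.Icc 0 T, freeCumulantOf ψ k (X t) =
      (((freeCumulantOf ψ k (X T)).re / T * t : ℝ) : ℂ) := fun k hk t ht =>
    hI.freeCumulantOf_eq_div_mul hψ1 hT hk (fun t ht => hcum t ht k (Nat.pos_of_ne_zero hk)) ht
  refine ⟨(freeCumulantOf ψ 1 (X T)).re / T, ⟨hX, hlin 1 one_ne_zero, fun t ht => ⟨?_, ?_⟩, ?_⟩⟩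
  · rw [hlin 2 two_ne_zero t ht, h2, Complex.ofReal_re, div_self hT.ne', one_mul]
  · have h := hX.variance 0 t le_rfl ht.1 ht.2
    rw [twoStateCumulantOf_two φ ψ (hX.mean_zero t ht)]
    simpa [hX.zero] using h
  · intro k hk' t ht
    rw [hlin k (by omega) t ht, hk k hk']
    simp
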